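/- Let $\mathsf C=\{0,1\}^{\mathbb N}\subseteq\mathbb N^{\mathbb N}$. For $F:\mathsf C\to\mathsf C$ define $f_\beta\in\mathsf C$ by transfinite recursion, with pointwise maxima and suprema: $f_0$ is constantly $0$, $f_{\beta+1}=\max\{f_\beta,F(f_\beta)\}$, and $f_\beta=\sup_{\gamma<\beta}f_\gamma$ for limit $\beta$. Let $\mathcal I(F)=f_{\alpha}$, where $\alpha$ is the least ordinal with $f_\alpha=f_{\alpha+1}$ (such a countable $\alpha$ exists). A functional $G:\mathbb N^{\mathbb N}\to\mathbb N$ codes the map $F_G:\mathsf C\to\mathsf C$, $F_G(f)(n)=\min\{G(n^\frown f),1\}$, where $n^\frown f$ is the function with values $n,f(0),f(1),\dots$; every map $\mathsf C\to\mathsf C$ has such a code. The Suslin functional $\mathsf S:\mathbb N^{\mathbb N}\to\mathbb N$ is given by $\mathsf S(f)=0$ if for every $g\in\mathbb N^{\mathbb N}$ there is an $n$ with $f(\overline g(n))=0$, and $\mathsf S(f)=1$ otherwise, where $\overline g(n)$ is the (code of the) sequence $\langle g(0),\dots,g(n-1)\rangle$. A Pincherle realiser is a functional $M$ assigning to each $F:\mathsf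 C\to\mathbb N$ a number $M(F)\in\mathbb N$ such that: whenever $G:\mathsf C\to\mathbb N$ satisfies $G(g)\le F(f)$ for all $f,g\in\mathsf C$ with $\overline g(F(f))=\overline f(F(f))$, then $G(g)\le M(F)$ for all $g\in\mathsf C$. It is regarded as a functional of pure type 3 by $M(H):=M(H|_{\mathsf C})$ for $H:\mathbb N^{\mathbb N}\to\mathbb N$. For finite sequences $\vec\Phi,\vec F,\vec f,\vec a$ of total objects of the pure types $3,2,1,0$, let $\{e\}(\vec\Phi,\vec F,\vec f,\vec a)=c$ be Kleene's relation, generated inductively by the schemes S1–S9: successor, constants, projection, composition, primitive recursion, permutation of arguments, application of a function, application of functionals of type $2$ and $3$ to totally defined computable arguments, and enumeration. **Lemma.** Let $M$ be a Pincherle realiser. Then $\mathcal I$ is Kleene-computable in $M$ and $\mathsf S$: there is an index $e\in\mathbb N$ such that for all $G:\mathbb N^{\mathbb N}\to\mathbb N$ and all $b\in\mathbb N$, $$\{e\}(M,\mathsf S,G,b)=\mathcal I(F_G)(b).$$ -/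

import Mathlib

/-! ### Cantor space and non-monotone induction -/

/-- The Cantor space of binary sequences, ordered and joined pointwise (so that, for
characteristic functions, `≤` is inclusion). -/
abbrev Cantor : Type := ℕ → Fin 2

/-- A binary sequence viewed as an element of `ℕ → ℕ`. -/
def Cantor.toBaire (f : Cantor) : ℕ → ℕ := fun n => (f n : ℕ)

/-- The transfinite sequence generated by `F`: `f_0` is constantly zero,
`f_{β+1} = max {f_β, F (f_β)}`, and `f_β = sup_{γ < β} f_γ` at limits. -/
noncomputable def indStage (F : Cantor → Cantor) (β : Ordinal.{0}) : Cantor :=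
  Ordinal.limitRecOn β (motive := fun _ => Cantor)
    (fun _ => 0)
    (fun _ f => f ⊔ F f)
    (fun β _ ih => ⨆ γ : Set.Iio β, ih γ.1 γ.2)

theorem indStage_zero (F : Cantor → Cantor) : indStage F 0 = fun _ => 0 := by
  simp [indStage]

theorem indStage_succ (F : Cantor → Cantor) (β : Ordinal.{0}) :
    indStage F (Order.succ β) = indStage F β ⊔ F (indStage F β) := by
  simp [indStage]

theorem indStage_limit (F : Cantor → Cantor) (β : Ordinal.{0}) (h : Order.IsSuccLimit β) :
    indStage F β = ⨆ γ : Set.Iio β, indStage F γ.1 := by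
  simp only [indStage]
  rw [Ordinal.limitRecOn_limit _ _ _ _ h]

theorem indStage_mono (F : Cantor → Cantor) {β γ : Ordinal.{0}} (h : β ≤ γ) :
    indStage F β ≤ indStage F γ := by
  induction γ using Ordinal.limitRecOn with
  | zero => rw [nonpos_iff_eq_zero.mp h]
  | add_one γ ih =>
    rcases h.eq_or_lt with rfl | h
    · exact le_rfl
    · rw [← Order.succ_eq_add_one, indStage_succ]
      exact (ih (Order.lt_add_one_iff.mp h)).trans le_sup_left
  | limit γ hγ ih =>
    rcases h.eq_or_lt with rfl | h
    · exact le_rfl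
    · rw [indStage_limit F γ hγ]
      exact le_iSup (fun δ : Set.Iio γ => indStage F δ.1) ⟨β, h⟩

/-- The sequence becomes stationary at some countable ordinal. -/
theorem exists_indStage_eq_succ (F : Cantor → Cantor) :
    ∃ α : Ordinal.{0}, α.card ≤ Cardinal.aleph0 ∧
      indStage F α = indStage F (Order.succ α) := by
  by_contra hcon
  push Not at hcon
  have key : ∀ β : Set.Iio (Ordinal.omega 1 : Ordinal.{0}),
      ∃ n, indStage F β.1 n < indStage F (Order.succ β.1) n := by
    rintro ⟨β, hβ⟩
    have hc : β.card ≤ Cardinal.aleph0 := by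
      have h1 : β.card < Cardinal.aleph 1 := by
        rw [Set.mem_Iio, ← Cardinal.ord_aleph] at hβ
        exact Cardinal.lt_ord.mp hβ
      rw [← Cardinal.succ_aleph0] at h1
      exact Order.lt_succ_iff.mp h1
    have hlt : indStage F β < indStage F (Order.succ β) :=
      lt_of_le_of_ne (indStage_mono F (Order.le_succ β)) (hcon β hc)
    exact (Pi.lt_def.mp hlt).2
  choose n hn using key
  have hinj : Function.Injective n := by
    have aux : ∀ β γ : Set.Iio (Ordinal.omega 1 : Ordinal.{0}), β.1 < γ.1 → n β ≠ n γ := by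
      intro β γ hlt heq
      have h1 := hn β
      have h2 := hn γ
      rw [← heq] at h2
      have h3 := indStage_mono F (Order.succ_le_of_lt hlt) (n β)
      have h4 := (indStage F (Order.succ γ.1) (n β)).isLt
      simp only [Fin.lt_def, Fin.le_def] at h1 h2 h3
      omega
    intro β γ heq
    rcases lt_trichotomy β.1 γ.1 with h | h | h
    · exact absurd heq (aux _ _ h)
    · exact Subtype.ext h
    · exact absurd heq.symm (aux _ _ h)
  have hct : Countable (Set.Iio (Ordinal.omega 1 : Ordinal.{0})) := hinj.countable
  have h1 := Cardinal.mk_le_aleph0_iff.mpr hct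
  rw [Cardinal.mk_Iio_ordinal, Ordinal.card_omega, Cardinal.lift_le_aleph0] at h1
  exact absurd h1 (not_le.mpr Cardinal.aleph0_lt_aleph_one)

/-- The closure ordinal: the least `α` with `f_α = f_{α+1}`; it exists and is countable
by `exists_indStage_eq_succ`. -/
noncomputable def closureOrdinal (F : Cantor → Cantor) : Ordinal.{0} :=
  sInf {α | indStage F α = indStage F (Order.succ α)}

/-- The functional of non-monotone induction, `𝓘(F) = f_α` at the closure ordinal `α` of `F`. -/
noncomputable def nonMonotoneInd (F : Cantor → Cantor) : Cantor :=
  indStage F (closureOrdinal F)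

/-! ### Functionals of pure type and finite sequences -/

/-- Total functionals of pure type 2. -/
abbrev Type2 : Type := (ℕ → ℕ) → ℕ

/-- Total functionals of pure type 3. -/
abbrev Type3 : Type := Type2 → ℕ

/-- The number `⟨x₁, …, xₖ⟩` coding a finite sequence of natural numbers. -/
def seqCode (l : List ℕ) : ℕ := Encodable.encode l

/-- The code `⟨g 0, …, g (n - 1)⟩` of the initial segment of `g` of length `n`. -/
def initSegCode (g : ℕ → ℕ) (n : ℕ) : ℕ := seqCode ((List.range n).map g)

/-- Concatenation: the function with values `n, f 0, f 1, …`. -/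
def consFun (n : ℕ) (f : ℕ → ℕ) : ℕ → ℕ
  | 0 => n
  | k + 1 => f k

/-- The map `F_G` on Cantor space coded by the type 2 functional `G`:
`F_G f n = min {G (n ⌢ f), 1}`. Every map `Cantor → Cantor` has such a code. -/
def mapOfCode (G : Type2) : Cantor → Cantor := fun f n =>
  ⟨min (G (consFun n f.toBaire)) 1, Nat.lt_succ_of_le (min_le_right _ _)⟩

/-- A functional acting on functions from Cantor space to `ℕ`, as a functional of pure type 3:
it acts on a type 2 functional through the restriction of the latter to Cantor space. -/
def pureOfCantor (M : (Cantor → ℕ) → ℕ) : Type3 := fun G => M fun f => G f.toBaire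

open Classical in
/-- The Suslin functional: value `0` if every `g` has an initial segment whose code is a zero
of `f`, and value `1` otherwise. -/
noncomputable def suslin : Type2 := fun f =>
  if ∀ g : ℕ → ℕ, ∃ n, f (initSegCode g n) = 0 then 0 else 1

/-- `M` is a Pincherle realiser: for each `F`, the number `M F` bounds every `G` for which `F`
is a realiser of local boundedness, that is, `G g ≤ F f` whenever `g` and `f` agree on their
first `F f` values. -/
def IsPincherleRealiser (M : (Cantor → ℕ) → ℕ) : Prop :=
  ∀ F G : Cantor → ℕ,
    (∀ f g : Cantor, (∀ i < F f, g i = f i) → G g ≤ F f) → ∀ g : Cantor, G g ≤ M F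

/-! ### Kleene computability -/

/-- The list `t` is a permutation of the indices `0, …, t.length - 1` of the first `t.length`
entries of `xs`; as a permutation of all indices of `xs`, it fixes the remaining ones. -/
def IsPermOf {α : Type*} (t : List ℕ) (xs : List α) : Prop :=
  t.length ≤ xs.length ∧ t.Perm (List.range t.length)

/-- The list `xs` rearranged by `t`: its `i`-th entry is entry number `t i` of `xs` for
`i < t.length`, and the remaining entries stay. -/
def permute {α : Type*} (t : List ℕ) (xs : List α) : List α :=
  t.filterMap (fun i => xs[i]?) ++ xs.drop t.length

/-- Kleene's relation `{e}(Φ, F, f, a) = c`, for finite sequences `Φ`, `F`, `f`, `a` of total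
objects of pure types `3`, `2`, `1`, `0`, inductively generated by the schemes S1 - S9. In S8 the
function, or the type 2 functional, to which an argument is applied has to be total. -/
inductive KleeneEval (Φ : List Type3) :
    ℕ → List Type2 → List (ℕ → ℕ) → List ℕ → ℕ → Prop
  /-- Successor. -/
  | s1 (F : List Type2) (f : List (ℕ → ℕ)) (x : ℕ) (a : List ℕ) :
      KleeneEval Φ (seqCode [1]) F f (x :: a) (x + 1)
  /-- Constants. -/
  | s2 (q : ℕ) (F : List Type2) (f : List (ℕ → ℕ)) (a : List ℕ) :
      KleeneEval Φ (seqCode [2, q]) F f a q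
  /-- Projection. -/
  | s3 (F : List Type2) (f : List (ℕ → ℕ)) (x : ℕ) (a : List ℕ) :
      KleeneEval Φ (seqCode [3]) F f (x :: a) x
  /-- Composition. -/
  | s4 {e₁ e₂ : ℕ} {F : List Type2} {f : List (ℕ → ℕ)} {a : List ℕ} {b c : ℕ}
      (h₂ : KleeneEval Φ e₂ F f a b) (h₁ : KleeneEval Φ e₁ F f (b :: a) c) :
      KleeneEval Φ (seqCode [4, e₁, e₂]) F f a c
  /-- Primitive recursion, at zero. -/
  | s5_zero {e₁ e₂ : ℕ} {F : List Type2} {f : List (ℕ → ℕ)} {a : List ℕ} {c : ℕ}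
      (h : KleeneEval Φ e₁ F f a c) :
      KleeneEval Φ (seqCode [5, e₁, e₂]) F f (0 :: a) c
  /-- Primitive recursion, at a successor. -/
  | s5_succ {e₁ e₂ : ℕ} {F : List Type2} {f : List (ℕ → ℕ)} {n : ℕ} {a : List ℕ} {b c : ℕ}
      (h : KleeneEval Φ (seqCode [5, e₁, e₂]) F f (n :: a) b)
      (h' : KleeneEval Φ e₂ F f (n :: b :: a) c) :
      KleeneEval Φ (seqCode [5, e₁, e₂]) F f ((n + 1) :: a) c
  /-- Permutation of the arguments of types 2, 1 and 0. -/
  | s6 {e₁ : ℕ} {t₁ t₂ t₃ : List ℕ} {F : List Type2} {f : List (ℕ → ℕ)} {a : List ℕ} {c : ℕ}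
      (p₁ : IsPermOf t₁ F) (p₂ : IsPermOf t₂ f) (p₃ : IsPermOf t₃ a)
      (h : KleeneEval Φ e₁ (permute t₁ F) (permute t₂ f) (permute t₃ a) c) :
      KleeneEval Φ (seqCode [6, e₁, seqCode t₁, seqCode t₂, seqCode t₃]) F f a c
  /-- Application of a function. -/
  | s7 (F : List Type2) (g : ℕ → ℕ) (f : List (ℕ → ℕ)) (x : ℕ) (a : List ℕ) :
      KleeneEval Φ (seqCode [7]) F (g :: f) (x :: a) (g x)
  /-- Application of a functional of type 2. -/
  | s8_two {d : ℕ} {H : Type2} {F : List Type2} {f : List (ℕ → ℕ)} {a : List ℕ} (g : ℕ → ℕ)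
      (h : ∀ n, KleeneEval Φ d (H :: F) f (n :: a) (g n)) :
      KleeneEval Φ (seqCode [8, 2, d]) (H :: F) f a (H g)
  /-- Application of the functional of type 3 with number `i` in the list `Φ`. -/
  | s8_three {i d : ℕ} {φ : Type3} {F : List Type2} {f : List (ℕ → ℕ)} {a : List ℕ}
      (hφ : Φ[i]? = some φ) (G : Type2)
      (h : ∀ g : ℕ → ℕ, KleeneEval Φ d F (g :: f) a (G g)) :
      KleeneEval Φ (seqCode [8, 3, i, d]) F f a (φ G)
  /-- Enumeration. -/
  | s9 {d : ℕ} {F : List Type2} {f : List (ℕ → ℕ)} {a : List ℕ} {c : ℕ}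
      (h : KleeneEval Φ d F f a c) :
      KleeneEval Φ (seqCode [9]) F f (d :: a) c

theorem seqCode_injective : Function.Injective seqCode := Encodable.encode_injective

/-- The relation `{e}(Φ, F, f, a) = c` is single-valued. -/
theorem KleeneEval.unique {Φ : List Type3} {e : ℕ} {F : List Type2} {f : List (ℕ → ℕ)}
    {a : List ℕ} {c c' : ℕ} (h : KleeneEval Φ e F f a c)
    (h' : KleeneEval Φ e F f a c') : c = c' := by
  induction h generalizing c' with
  | s1 => generalize he : seqCode [1] = e at h'; cases h' <;> first | rfl | (have := seqCode_injective he; simp at this)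
  | s2 => 
    generalize he : seqCode _ = e at h'; cases h' <;> have := seqCode_injective he <;> simp_all
  | s3 => generalize he : seqCode _ = e at h'; cases h' <;> have := seqCode_injective he <;> simp_all
  | s4 h₂ h₁ ih₂ ih₁ => 
    generalize he : seqCode _ = e at h'; cases h' <;> have := seqCode_injective he <;> simp at this
    obtain ⟨rfl, rfl⟩ := this
    rename_i x y z; obtain rfl := ih₂ z; exact ih₁ y
  | s5_zero h ih => 
    generalize he : seqCode _ = e at h'; cases h' <;> have := seqCode_injective he <;> simp at this
    obtain ⟨rfl, rfl⟩ := this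
    exact ih (by assumption)
  | s5_succ h h2 ih ih2 => 
    generalize he : seqCode _ = e at h'; cases h' <;> have := seqCode_injective he <;> simp at this
    obtain ⟨rfl, rfl⟩ := this
    rename_i x y z; obtain rfl := ih z; exact ih2 y
  | s6 p1 p2 p3 h ih => 
    generalize he : seqCode _ = e at h'; cases h' <;> have := seqCode_injective he <;> simp at this
    obtain ⟨rfl, h1, h2, h3⟩ := this
    rename_i h4
    rw [← seqCode_injective h1, ← seqCode_injective h2, ← seqCode_injective h3] at h4
    exact ih h4
  | s7 => generalize he : seqCode _ = e at h'; cases h' <;> have := seqCode_injective he <;> simp_all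
  | s8_two g h ih =>
    generalize he : seqCode _ = e at h'; cases h' <;> have := seqCode_injective he <;> simp at this
    subst this
    rename_i g' h'
    congr 1; funext n; exact ih n (h' n)
  | s8_three hφ G h ih =>
    generalize he : seqCode _ = e at h'; cases h' <;> have := seqCode_injective he <;> simp at this
    obtain ⟨rfl, rfl⟩ := this
    rename_i G' hp h'
    obtain rfl : _ = _ := Option.some.inj (hφ.symm.trans hp)
    congr 1; funext n; exact ih n (h' n)
  | s9 h ih =>
    generalize he : seqCode _ = e at h'; cases h' <;> have := seqCode_injective he <;> simp at this
    exact ih (by assumption)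

/-- The functional `Ψ`, with one argument of type 2 and one of type 0, is Kleene-computable in
the given functionals `Φ` of type 3 and `F` of type 2: for one index `e`, we have
`{e}(Φ, F, G, b) = Ψ(G, b)` for all `G` and `b`. -/
def KleeneComputableIn (Φ : List Type3) (F : List Type2) (Ψ : Type2 → ℕ → ℕ) : Prop :=
  ∃ e : ℕ, ∀ (G : Type2) (b : ℕ), KleeneEval Φ e (F ++ [G]) [] [b] (Ψ G b)

/-!
The history of the induction given by `F` is the relation "`n` enters strictly before `m`" on numbers,
where an `m` that never enters counts as coming last. Each of its rows `{n | n` precedes `m}` is a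
stage of the induction (`exists_row_history_eq`), and `b` enters if and only if `F` applied to the row
of `b` has value `1` at `b` (`mem_finalSet_iff`). So the outcome can be read off from the history; but
there is no evident way to compute the history, as a realiser only gives upper bounds.

What can be computed, for an alleged history `R` given as an element of Cantor space, is whether it
is the true one, and a position of an error if it is not. The Suslin functional decides which rows
are well-founded and locally correct hereditarily (`Verified`); those rows are right
(`Verified.row_eq`). If all rows are verified, `R` is the history. Otherwise the verified rows suffice
to compute the stage that the induction has reached where `R` first goes wrong, and to find a pair at
which `R` differs from the history (`exists_errorAt`, `ErrorAt.not_iff`).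

Given numbers `b` and `k`, let the `probe` map an `R` that is not the history to the length of an
initial segment that contains such an error, and map the history to `k` if `b` enters and to `0`
otherwise. The neighbourhoods that this functional assigns to the points of Cantor space cover the
history only by its own neighbourhood (`eq_historyCantor_of_agree`). If `b` enters, the value of a
Pincherle realiser `M` at the probe is therefore at least `k`, since the function with value `k` at
the history and `0` elsewhere is locally bounded as required (`le_realiser_probe`). If `b` does not
enter, the probe does not depend on `k`, and neither does the value of `M`. Thus, with `N` the value
for `k = 0`, the number `b` enters if and only if the value for `k = N + 1` differs from `N`
(`mem_finalSet_iff_realiser_ne`).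

The probe is computed in `S` and `G` from closure properties of Kleene computability: all primitive
recursive functions are computable (`KleeneIndexed.of_primrec'`), the Suslin functional gives numerical
quantifiers and well-foundedness (`KleeneDec.exists_nat`, `KleeneDec.acc`), and enumeration S9 gives
unbounded search (`KleeneComp.find`), which locates the error.
-/

/-! ### Stages of an induction, as sets -/

open Classical in
/-- The element of Cantor space that is the characteristic function of `s`. -/
noncomputable def charCantor (s : Set ℕ) : Cantor := fun n => if n ∈ s then 1 else 0

/-- The operator on sets of numbers that corresponds to a map of Cantor space. -/
def setOp (F : Cantor → Cantor) (s : Set ℕ) : Set ℕ := {n | F (charCantor s) n = 1}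

/-- The stage `f_β` of the induction, as a set of numbers. -/
def stage (F : Cantor → Cantor) (β : Ordinal.{0}) : Set ℕ := {n | indStage F β n = 1}

/-- The outcome `𝓘(F)` of the induction, as a set of numbers. -/
def finalSet (F : Cantor → Cantor) : Set ℕ := {n | nonMonotoneInd F n = 1}

theorem charCantor_setOf_eq_one (f : Cantor) : charCantor {n | f n = 1} = f := by
  funext n
  simp only [charCantor, Set.mem_ofPred_eq]
  split_ifs <;> omega

section

variable (F : Cantor → Cantor)

theorem stage_zero : stage F 0 = ∅ := by
  ext n; simp [stage, indStage_zero]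

theorem stage_succ (β : Ordinal.{0}) :
    stage F (Order.succ β) = stage F β ∪ setOp F (stage F β) := by
  ext n
  have h : charCantor (stage F β) = indStage F β := charCantor_setOf_eq_one _
  simp only [stage, setOp, indStage_succ, Set.mem_union, Set.mem_ofPred_eq, Pi.sup_apply] at h ⊢
  rw [h]
  generalize indStage F β n = a
  generalize F (indStage F β) n = b
  revert a b; decide

theorem stage_limit {β : Ordinal.{0}} (h : Order.IsSuccLimit β) :
    stage F β = ⋃ γ < β, stage F γ := by
  ext n
  simp only [stage, indStage_limit F β h, Set.mem_ofPred_eq, iSup_apply, Set.mem_iUnion]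
  constructor
  · intro hn
    by_contra! hcon
    have : (⨆ γ : Set.Iio β, indStage F γ.1 n) ≤ 0 :=
      iSup_le fun γ => by have := hcon γ.1 γ.2; omega
    rw [hn] at this
    exact absurd this (by decide)
  · rintro ⟨γ, hγ, hn⟩
    have : indStage F γ n ≤ ⨆ γ : Set.Iio β, indStage F γ.1 n :=
      le_iSup (fun γ : Set.Iio β => indStage F γ.1 n) ⟨γ, hγ⟩
    rw [hn] at this
    omega

theorem stage_mono {β γ : Ordinal.{0}} (h : β ≤ γ) : stage F β ⊆ stage F γ := by
  intro n hn
  have : indStage F β n ≤ indStage F γ n := indStage_mono F h n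
  simp only [stage, Set.mem_ofPred_eq] at hn ⊢
  omega

variable {F} in
theorem lt_of_mem_stage_of_notMem {n : ℕ} {β γ : Ordinal.{0}} (h : n ∈ stage F γ)
    (h' : n ∉ stage F β) : β < γ :=
  lt_of_not_ge fun hle => h' (stage_mono F hle h)

variable {F} in
/-- Nothing enters any more after a closed stage. -/
theorem stage_subset_of_closed {β : Ordinal.{0}} (h : setOp F (stage F β) ⊆ stage F β)
    (γ : Ordinal.{0}) : stage F γ ⊆ stage F β := by
  induction γ using Ordinal.limitRecOn with
  | zero => simp [stage_zero]
  | add_one γ ih =>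
    rcases le_or_gt β γ with hle | hlt
    · have heq : stage F γ = stage F β := ih.antisymm (stage_mono F hle)
      rw [← Order.succ_eq_add_one, stage_succ, heq]
      exact Set.union_subset le_rfl h
    · exact stage_mono F (Order.succ_le_of_lt hlt)
  | limit γ hγ ih =>
    rw [stage_limit F hγ]
    exact Set.iUnion₂_subset ih

theorem exists_stage_eq_finalSet : ∃ α, stage F α = finalSet F ∧ setOp F (stage F α) ⊆ stage F α := by
  refine ⟨closureOrdinal F, rfl, ?_⟩
  have hmem : closureOrdinal F ∈ {α | indStage F α = indStage F (Order.succ α)} :=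
    csInf_mem ((exists_indStage_eq_succ F).imp fun _ h => h.2)
  have h : stage F (closureOrdinal F) = stage F (Order.succ (closureOrdinal F)) := by
    have h1 : indStage F (closureOrdinal F) = indStage F (Order.succ (closureOrdinal F)) := hmem
    unfold stage
    rw [← h1]
  rw [stage_succ] at h
  exact Set.union_eq_left.1 h.symm

theorem stage_subset_finalSet (β : Ordinal.{0}) : stage F β ⊆ finalSet F := by
  obtain ⟨α, hα, hc⟩ := exists_stage_eq_finalSet F
  exact hα ▸ stage_subset_of_closed hc β

variable {F} in
theorem finalSet_eq_of_closed {β : Ordinal.{0}} (h : setOp F (stage F β) ⊆ stage F β) :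
    finalSet F = stage F β := by
  obtain ⟨α, hα, -⟩ := exists_stage_eq_finalSet F
  exact (hα ▸ stage_subset_of_closed h α).antisymm (stage_subset_finalSet F β)

/-- Every union of stages is a stage. -/
theorem exists_stage_eq_biUnion (X : Set Ordinal.{0}) : ∃ δ, stage F δ = ⋃ β ∈ X, stage F β := by
  classical
  have hex : ∃ δ, ⋃ β ∈ X, stage F β ⊆ stage F δ := by
    obtain ⟨α, hα, -⟩ := exists_stage_eq_finalSet F
    exact ⟨α, Set.iUnion₂_subset fun β _ => hα ▸ stage_subset_finalSet F β⟩
  -- the least stage that contains the union is not larger than it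
  set δ := sInf {δ | ⋃ β ∈ X, stage F β ⊆ stage F δ} with hδ
  have h1 : ⋃ β ∈ X, stage F β ⊆ stage F δ := csInf_mem hex
  have h2 : ∀ γ < δ, stage F (Order.succ γ) ⊆ ⋃ β ∈ X, stage F β := by
    intro γ hγ
    have hn : ¬ ⋃ β ∈ X, stage F β ⊆ stage F γ := notMem_of_lt_csInf' hγ
    obtain ⟨n, hn, hnγ⟩ := Set.not_subset.1 hn
    obtain ⟨β, hβ, hnβ⟩ := Set.mem_iUnion₂.1 hn
    exact (stage_mono F (Order.succ_le_of_lt (lt_of_mem_stage_of_notMem hnβ hnγ))).trans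
      (Set.subset_biUnion_of_mem (u := fun β => stage F β) hβ)
  refine ⟨δ, subset_antisymm ?_ h1⟩
  clear_value δ
  rcases Ordinal.zero_or_succ_or_isSuccLimit δ with h0 | ⟨γ, rfl⟩ | hl
  · simp [h0, stage_zero]
  · exact h2 γ (Order.lt_succ γ)
  · rw [stage_limit F hl]
    exact Set.iUnion₂_subset fun γ hγ => (stage_mono F (Order.le_succ γ)).trans (h2 γ hγ)

/-! ### The history of an induction -/

/-- The set of predecessors of `m`. -/
def row (R : ℕ → ℕ → Prop) (m : ℕ) : Set ℕ := {n | R n m}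

/-- The history of the induction: `n` enters strictly before `m`, where an `m` that never enters
counts as coming after all those that do. -/
def history (n m : ℕ) : Prop := ∃ β, n ∈ stage F β ∧ m ∉ stage F β

/-- `m` may come next after `C`: it is new, and either it enters now, or nothing new enters. -/
def IsNext (C : Set ℕ) (m : ℕ) : Prop :=
  m ∉ C ∧ (m ∈ setOp F C ∨ setOp F C ⊆ C)

variable {F}

/-- If `m` comes next after a stage, then that stage is the row of `m` in the history. -/
theorem row_history_eq {γ : Ordinal.{0}} {m : ℕ} (h : IsNext F (stage F γ) m) :
    row (history F) m = stage F γ := by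
  refine subset_antisymm ?_ fun n hn => ⟨γ, hn, h.1⟩
  rintro n ⟨β, hn, hm⟩
  rcases h.2 with h2 | h2
  -- `m` enters at stage `γ + 1`, so a stage without `m` that is beyond `γ` is impossible
  · by_contra hnγ
    have hlt := lt_of_mem_stage_of_notMem hn hnγ
    refine hm (stage_mono F (Order.succ_le_of_lt hlt) ?_)
    rw [stage_succ]
    exact Or.inr h2
  · exact stage_subset_of_closed h2 β hn

theorem exists_row_history_eq (F : Cantor → Cantor) (m : ℕ) :
    ∃ γ, row (history F) m = stage F γ ∧ IsNext F (stage F γ) m := by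
  suffices ∃ γ, IsNext F (stage F γ) m from this.imp fun γ h => ⟨row_history_eq h, h⟩
  obtain ⟨α, hα, hc⟩ := exists_stage_eq_finalSet F
  by_cases hm : m ∈ stage F α
  · set β := sInf {β | m ∈ stage F β} with hβ
    have h1 : m ∈ stage F β := csInf_mem (⟨α, hm⟩ : Set.Nonempty {β | m ∈ stage F β})
    have h2 : ∀ γ < β, m ∉ stage F γ := fun γ hγ =>
      notMem_of_lt_csInf' (s := {β | m ∈ stage F β}) hγ
    clear_value β
    rcases Ordinal.zero_or_succ_or_isSuccLimit β with h0 | ⟨γ, rfl⟩ | hl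
    · simp [h0, stage_zero] at h1
    · have h3 := h2 γ (Order.lt_succ γ)
      rw [stage_succ] at h1
      exact ⟨γ, h3, Or.inl (h1.resolve_left h3)⟩
    · rw [stage_limit F hl] at h1
      obtain ⟨γ, hγ, hmγ⟩ := Set.mem_iUnion₂.1 h1
      exact absurd hmγ (h2 γ hγ)
  · exact ⟨α, hm, Or.inr hc⟩

/-- A number enters if and only if the operator, applied to its row in the history, yields it. -/
theorem mem_finalSet_iff (m : ℕ) : m ∈ finalSet F ↔ m ∈ setOp F (row (history F) m) := by
  obtain ⟨γ, h, hm, h2⟩ := exists_row_history_eq F m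
  rw [h]
  constructor
  · intro hf
    refine h2.resolve_right fun hc => hm ?_
    rwa [← finalSet_eq_of_closed hc]
  · intro hf
    refine stage_subset_finalSet F (Order.succ γ) ?_
    rw [stage_succ]
    exact Or.inr hf

/-! ### Finding an error in an alleged history -/

/-- The union of the rows of the elements of `s`, each together with what enters next after it. If
the rows are stages `f_β`, this is the union of the stages `f_{β+1}`. -/
def unionNext (F : Cantor → Cantor) (R : ℕ → ℕ → Prop) (s : Set ℕ) : Set ℕ :=
  {j | ∃ m ∈ s, j ∈ row R m ∨ j ∈ setOp F (row R m)}

/-- The row of `m` in `R` consists of what has entered with its elements, and `m` may come next after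
it. That `m` is not in its own row is left to the requirement of well-foundedness. -/
def LocallyCorrect (F : Cantor → Cantor) (R : ℕ → ℕ → Prop) (m : ℕ) : Prop :=
  row R m = unionNext F R (row R m) ∧
    (m ∈ setOp F (row R m) ∨ setOp F (row R m) ⊆ row R m)

/-- The relation `R` with a loop added at each `m` that is not locally correct, so that these are
outside the well-founded part. -/
def errorRel (F : Cantor → Cantor) (R : ℕ → ℕ → Prop) (n m : ℕ) : Prop :=
  R n m ∨ ¬ LocallyCorrect F R m ∧ n = m

/-- The row of `m` is well-founded and locally correct hereditarily. -/
def Verified (F : Cantor → Cantor) (R : ℕ → ℕ → Prop) (m : ℕ) : Prop :=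
  Acc (errorRel F R) m

variable {R : ℕ → ℕ → Prop}

theorem verified_iff {m : ℕ} :
    Verified F R m ↔ LocallyCorrect F R m ∧ ∀ n, R n m → Verified F R n := by
  constructor
  · intro h
    refine ⟨?_, fun n hn => h.inv (Or.inl hn)⟩
    by_contra hl
    have key : ∀ m, Acc (errorRel F R) m → LocallyCorrect F R m := by
      intro m hm
      induction hm with
      | intro m _ ih =>
        by_contra hl
        exact hl (ih m (Or.inr ⟨hl, rfl⟩))
    exact hl (key m h)
  · rintro ⟨hl, h⟩
    refine Acc.intro m ?_
    rintro n (hn | ⟨hl', -⟩)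
    exacts [h n hn, absurd hl hl']

theorem Verified.locallyCorrect {m : ℕ} (h : Verified F R m) : LocallyCorrect F R m :=
  (verified_iff.1 h).1

theorem Verified.of_rel {n m : ℕ} (h : Verified F R m) (hn : R n m) : Verified F R n :=
  (verified_iff.1 h).2 n hn

theorem Verified.irrefl {m : ℕ} (h : Verified F R m) : ¬ R m m := by
  unfold Verified at h
  induction h with
  | intro m _ ih => exact fun hm => ih m (Or.inl hm) hm

theorem exists_stage_eq_unionNext {s : Set ℕ} (h : ∀ n ∈ s, ∃ γ, row R n = stage F γ) :
    ∃ δ, unionNext F R s = stage F δ := by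
  obtain ⟨δ, hδ⟩ := exists_stage_eq_biUnion F
    {β | ∃ n ∈ s, ∃ γ, row R n = stage F γ ∧ β = Order.succ γ}
  refine ⟨δ, hδ ▸ Set.ext fun j => ?_⟩
  simp only [unionNext, Set.mem_ofPred_eq, Set.mem_iUnion, exists_prop]
  constructor
  · rintro ⟨n, hn, hj⟩
    obtain ⟨γ, hγ⟩ := h n hn
    refine ⟨_, ⟨n, hn, γ, hγ, rfl⟩, ?_⟩
    rwa [stage_succ, ← hγ]
  · rintro ⟨_, ⟨n, hn, γ, hγ, rfl⟩, hj⟩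
    refine ⟨n, hn, ?_⟩
    rwa [stage_succ, ← hγ] at hj

theorem Verified.exists_row_eq {m : ℕ} (h : Verified F R m) : ∃ γ, row R m = stage F γ := by
  have h' := h
  unfold Verified at h'
  induction h' with
  | intro m _ ih =>
    rw [h.locallyCorrect.1]
    exact exists_stage_eq_unionNext fun n hn => ih n (Or.inl hn) (h.of_rel hn)

/-- A verified row is a stage, after which `m` comes next; so it is the row of the history. -/
theorem Verified.row_eq {m : ℕ} (h : Verified F R m) : row R m = row (history F) m := by
  obtain ⟨γ, hγ⟩ := h.exists_row_eq
  rw [hγ]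
  exact (row_history_eq (hγ ▸ ⟨h.irrefl, h.locallyCorrect.2⟩)).symm

variable (F) in
theorem verified_history (m : ℕ) : Verified F (history F) m := by
  choose γ hγ hnext using exists_row_history_eq F
  have hloc : ∀ m, LocallyCorrect F (history F) m := by
    refine fun m => ⟨?_, hγ m ▸ (hnext m).2⟩
    rw [hγ m]
    refine subset_antisymm ?_ ?_
    · refine fun j hj => ⟨j, hj, Or.inr ?_⟩
      exact (mem_finalSet_iff j).1 (stage_subset_finalSet F _ hj)
    · rintro j ⟨n, hn, hj⟩
      have hlt : γ n < γ m := lt_of_mem_stage_of_notMem hn (hnext n).1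
      refine stage_mono F (Order.succ_le_of_lt hlt) ?_
      rw [stage_succ, ← hγ n]
      exact hj
  refine (InvImage.wf γ (wellFounded_lt (α := Ordinal.{0}))).induction
    (C := fun m => Verified F (history F) m) m fun m ih => ?_
  refine verified_iff.2 ⟨hloc m, fun n hn => ih n ?_⟩
  have hn' : n ∈ stage F (γ m) := hγ m ▸ hn
  exact lt_of_mem_stage_of_notMem hn' (hnext n).1

/-- `R` errs about whether `j` precedes `n`: the row of `n` is known to be the set `C`, which is a
verified row or the union of the stages reached by the verified part of `R`. -/
def ErrorAt (F : Cantor → Cantor) (R : ℕ → ℕ → Prop) (j n : ℕ) : Prop :=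
  (∃ m, Verified F R m ∧ IsNext F (row R m) n ∧ ¬ (R j n ↔ j ∈ row R m)) ∨
    IsNext F (unionNext F R {m | Verified F R m}) n ∧
      ¬ (R j n ↔ j ∈ unionNext F R {m | Verified F R m})

theorem ErrorAt.not_iff {j n : ℕ} (h : ErrorAt F R j n) : ¬ (R j n ↔ history F j n) := by
  have key : ∀ C : Set ℕ, (∃ γ, C = stage F γ) → IsNext F C n → ¬ (R j n ↔ j ∈ C) →
      ¬ (R j n ↔ history F j n) := by
    rintro _ ⟨γ, rfl⟩ hn hj
    rwa [← row_history_eq hn] at hj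
  rcases h with ⟨m, hm, hn, hj⟩ | ⟨hn, hj⟩
  · exact key _ hm.exists_row_eq hn hj
  · exact key _ (exists_stage_eq_unionNext fun m hm => Verified.exists_row_eq hm) hn hj

/-- Without an error every row is verified: otherwise the verified part could be extended. -/
theorem exists_errorAt (h : ¬ ∀ m, Verified F R m) : ∃ j n, ErrorAt F R j n := by
  by_contra! hcon
  refine h ?_
  set B := unionNext F R {m | Verified F R m} with hB
  -- without errors, the rows of the elements that come next are as they should be
  have h1 : ∀ m n, Verified F R m → IsNext F (row R m) n → row R n = row R m := by
    intro m n hm hn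
    ext j
    by_contra hj
    exact hcon j n (Or.inl ⟨m, hm, hn, hj⟩)
  have h2 : ∀ n, IsNext F B n → row R n = B := by
    intro n hn
    ext j
    by_contra hj
    exact hcon j n (Or.inr ⟨hn, hj⟩)
  have hBver : ∀ n ∈ B, Verified F R n := by
    rintro n ⟨m, hm, hn⟩
    by_cases hnm : n ∈ row R m
    · exact Verified.of_rel hm hnm
    · have hnext : IsNext F (row R m) n := ⟨hnm, Or.inl (hn.resolve_left hnm)⟩
      have heq := h1 m n hm hnext
      refine verified_iff.2 ⟨⟨?_, heq ▸ hnext.2⟩, fun j hj => ?_⟩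
      · rw [heq]; exact (Verified.locallyCorrect hm).1
      · exact Verified.of_rel hm (heq ▸ hj : j ∈ row R m)
  obtain ⟨δ, hδ⟩ : ∃ δ, B = stage F δ :=
    exists_stage_eq_unionNext fun m hm => Verified.exists_row_eq hm
  have hBnext : ∀ n, IsNext F B n → Verified F R n := by
    intro n hn
    have heq := h2 n hn
    refine verified_iff.2 ⟨⟨?_, heq ▸ hn.2⟩, fun j hj => hBver j (heq ▸ hj : j ∈ B)⟩
    rw [heq]
    refine subset_antisymm ?_ ?_
    · refine fun j hj => ⟨j, hj, Or.inr ?_⟩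
      rw [(hBver j hj).row_eq]
      exact (mem_finalSet_iff j).1 (stage_subset_finalSet F δ (hδ ▸ hj))
    · rintro j ⟨m, hm, hj⟩
      exact ⟨m, hBver m hm, hj⟩
  have hclosed : setOp F B ⊆ B := by
    intro n hn
    by_contra hnB
    have hnext : IsNext F B n := ⟨hnB, Or.inl hn⟩
    exact hnB ⟨n, hBnext n hnext, Or.inr (h2 n hnext ▸ hn)⟩
  intro n
  by_cases hn : n ∈ B
  · exact hBver n hn
  · exact hBnext n ⟨hn, Or.inr hclosed⟩

end

/-! ### Schemes S1 - S6: the primitive recursive functions -/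

theorem isPermOf_nil {α : Type*} (xs : List α) : IsPermOf [] xs := by
  simp [IsPermOf]

theorem permute_nil {α : Type*} (xs : List α) : permute [] xs = xs := by
  simp [permute]

theorem filterMap_getElem?_range {α : Type*} (u r : List α) :
    (List.range u.length).filterMap (fun i => (u ++ r)[i]?) = u := by
  induction u using List.reverseRecOn generalizing r with
  | nil => simp
  | append_singleton u x ih => simp [List.range_succ, ih]

theorem filterMap_getElem?_range' {α : Type*} (u v r : List α) :
    (List.range' u.length v.length).filterMap (fun i => (u ++ (v ++ r))[i]?) = v := by
  rw [List.range'_eq_map_range, List.filterMap_map]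
  simpa [Function.comp_def, List.getElem?_append_right] using filterMap_getElem?_range v r

/-- Moving a block of numerical arguments to the front, over the block before it. -/
theorem exists_index_rotate (e k n : ℕ) : ∃ e', ∀ (Φ : List Type3) (F : List Type2)
    (f : List (ℕ → ℕ)) (u v w : List ℕ) (c : ℕ), u.length = k → v.length = n →
      KleeneEval Φ e F f (v ++ (u ++ w)) c → KleeneEval Φ e' F f (u ++ (v ++ w)) c := by
  refine ⟨seqCode [6, e, seqCode [], seqCode [], seqCode (List.range' k n ++ List.range k)], ?_⟩
  rintro Φ F f u v w c rfl rfl h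
  have hperm : (List.range' u.length v.length ++ List.range u.length).Perm
      (List.range (v.length + u.length)) := by
    rw [List.range_eq_range', List.range_eq_range', add_comm v.length]
    refine List.perm_append_comm.trans ?_
    rw [← List.range'_append]
    simp
  refine KleeneEval.s6 (isPermOf_nil _) (isPermOf_nil _) ⟨?_, ?_⟩ ?_
  · simp; omega
  · simpa using hperm
  · have : permute (List.range' u.length v.length ++ List.range u.length) (u ++ (v ++ w)) =
        v ++ (u ++ w) := by
      unfold permute
      rw [List.filterMap_append, filterMap_getElem?_range', filterMap_getElem?_range]
      have h2 : u ++ (v ++ w) = (u ++ v) ++ w := by simp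
      rw [h2, List.drop_append_of_le_length (by simp; omega), List.drop_of_length_le (by simp; omega)]
      simp
    rwa [permute_nil, permute_nil, this]

/-- The function `f` of `n` numbers is computed by one index for all choices of the given
functionals and functions. The index ignores the numerical arguments after the first `n`, which
makes it usable in contexts with additional arguments. -/
def KleeneIndexed {n : ℕ} (f : List.Vector ℕ n → ℕ) : Prop :=
  ∃ e, ∀ (Φ : List Type3) (F : List Type2) (fs : List (ℕ → ℕ)) (v : List.Vector ℕ n) (w : List ℕ),
    KleeneEval Φ e F fs (v.toList ++ w) (f v)

/-- Composition S4, iterated: an index can be run on the values of several functions, followed by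
the original arguments. -/
theorem exists_index_push_of_indexed {n : ℕ} (gs : List (List.Vector ℕ n → ℕ))
    (hg : ∀ g ∈ gs, KleeneIndexed g) (e : ℕ) : ∃ e', ∀ (Φ : List Type3) (F : List Type2)
    (f : List (ℕ → ℕ)) (v : List.Vector ℕ n) (w : List ℕ) (c : ℕ),
      KleeneEval Φ e F f (gs.map (fun g => g v) ++ (v.toList ++ w)) c →
        KleeneEval Φ e' F f (v.toList ++ w) c := by
  induction gs generalizing e with
  | nil => exact ⟨e, fun Φ F f v w c h => by simpa using h⟩
  | cons g gs ih =>
    obtain ⟨eg, hg'⟩ := hg g (by simp)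
    obtain ⟨er, hr⟩ := exists_index_rotate eg gs.length n
    obtain ⟨e', h'⟩ := ih (fun g hgs => hg g (by simp [hgs])) (seqCode [4, e, er])
    refine ⟨e', fun Φ F f v w c h => h' Φ F f v w c ?_⟩
    exact KleeneEval.s4 (hr Φ F f _ _ _ _ (by simp) (by simp) (hg' Φ F f v _)) h

theorem KleeneIndexed.of_primrec' {n : ℕ} {f : List.Vector ℕ n → ℕ} (h : Nat.Primrec' f) :
    KleeneIndexed f := by
  induction h with
  | zero => exact ⟨seqCode [2, 0], fun Φ F fs v w => KleeneEval.s2 0 F fs _⟩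
  | succ =>
    refine ⟨seqCode [1], fun Φ F fs v w => ?_⟩
    obtain ⟨x, v, rfl⟩ := v.exists_eq_cons
    exact KleeneEval.s1 F fs x _
  | @get n i =>
    obtain ⟨e, he⟩ := exists_index_rotate (seqCode [3]) i (n - i)
    refine ⟨e, fun Φ F fs v w => ?_⟩
    have h1 : v.toList ++ w = v.toList.take i ++ (v.toList.drop i ++ w) := by
      rw [← List.append_assoc, List.take_append_drop]
    rw [h1]
    have hi : (i : ℕ) < v.toList.length := by simp
    refine he Φ F fs _ _ _ _ (by simp [i.isLt.le]) (by simp) ?_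
    rw [List.drop_eq_getElem_cons hi, List.cons_append]
    have h2 : v.toList[(i : ℕ)] = v.get i := by
      simp [List.Vector.get_eq_get_toList]
    rw [h2]
    exact KleeneEval.s3 F fs _ _
  | @comp m n f g hf hg ihf ihg =>
    obtain ⟨e, he⟩ := ihf
    obtain ⟨e', he'⟩ := exists_index_push_of_indexed (List.ofFn g)
      (by intro a ha; obtain ⟨i, rfl⟩ := (List.mem_ofFn' _ _).1 ha; exact ihg i) e
    refine ⟨e', fun Φ F fs v w => he' Φ F fs v w _ ?_⟩
    have := he Φ F fs (List.Vector.ofFn fun i => g i v) (v.toList ++ w)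
    rw [List.Vector.toList_ofFn] at this
    simpa [List.map_ofFn, Function.comp_def] using this
  | @prec n f g hf hg ihf ihg =>
    obtain ⟨e₁, h₁⟩ := ihf
    obtain ⟨e₂, h₂⟩ := ihg
    refine ⟨seqCode [5, e₁, e₂], fun Φ F fs v w => ?_⟩
    obtain ⟨x, v, rfl⟩ := v.exists_eq_cons
    simp only [List.Vector.toList_cons, List.cons_append, List.Vector.head_cons,
      List.Vector.tail_cons]
    induction x with
    | zero => exact KleeneEval.s5_zero (h₁ Φ F fs v w)
    | succ x ih => exact KleeneEval.s5_succ ih (by simpa using h₂ Φ F fs (x ::ᵥ _ ::ᵥ v) w)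

/-- Running an index on the values of primitive recursive functions, followed by the original
arguments. -/
theorem exists_index_push {n : ℕ} (gs : List (List.Vector ℕ n → ℕ))
    (hg : ∀ g ∈ gs, Primrec g) (e : ℕ) : ∃ e', ∀ (Φ : List Type3) (F : List Type2)
    (f : List (ℕ → ℕ)) (v : List.Vector ℕ n) (w : List ℕ) (c : ℕ),
      KleeneEval Φ e F f (gs.map (fun g => g v) ++ (v.toList ++ w)) c →
        KleeneEval Φ e' F f (v.toList ++ w) c :=
  exists_index_push_of_indexed gs
    (fun g h => .of_primrec' (Nat.Primrec'.of_prim (hg g h))) e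

/-! ### Computability relative to functionals of types 3, 2 and 1 -/

/-- For an environment `E`, which supplies for each `i` a functional of type 2 and a list of
functions: `ψ i x` is computed from (the code of) `x`, by one index for all `i` and `x`, in `Φ`, the
Suslin functional and the environment. Additional numerical arguments are ignored. -/
def KleeneComp (Φ : List Type3) {ι α : Type*} [Primcodable α] (E : ι → Type2 × List (ℕ → ℕ))
    (ψ : ι → α → ℕ) : Prop :=
  ∃ e, ∀ (i : ι) (x : α) (w : List ℕ),
    KleeneEval Φ e [suslin, (E i).1] (E i).2 (Encodable.encode x :: w) (ψ i x)

namespace KleeneComp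

variable {Φ : List Type3} {ι α β : Type*} [Primcodable α] [Primcodable β]
  {E : ι → Type2 × List (ℕ → ℕ)}

/-- Substitution of a value and the original argument for a pair. -/
theorem bind {φ : ι → ℕ × α → ℕ} {ψ : ι → α → ℕ} (hφ : KleeneComp Φ E φ)
    (hψ : KleeneComp Φ E ψ) : KleeneComp Φ E fun i x => φ i (ψ i x, x) := by
  obtain ⟨e, he⟩ := hφ
  obtain ⟨d, hd⟩ := hψ
  obtain ⟨e', he'⟩ := exists_index_push (n := 2) [fun v => Nat.pair (v.get 0) (v.get 1)]
    (by
      simp only [List.mem_singleton, forall_eq]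
      exact Primrec₂.natPair.comp (Primrec.vector_get.comp .id (.const 0))
        (Primrec.vector_get.comp .id (.const 1))) e
  refine ⟨seqCode [4, e', d], fun i x w => KleeneEval.s4 (hd i x w) ?_⟩
  exact he' Φ _ _ ⟨[ψ i x, Encodable.encode x], rfl⟩ w _ (he i (ψ i x, x) _)

theorem comp_prim {φ : ι → β → ℕ} (hφ : KleeneComp Φ E φ) {g : α → β} (hg : Primrec g) :
    KleeneComp Φ E fun i x => φ i (g x) := by
  obtain ⟨e, he⟩ := hφ
  have hg' : Primrec fun n : ℕ =>
      ((Encodable.decode (α := α) n).map fun x => Encodable.encode (g x)).getD 0 :=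
    Primrec.option_getD.comp
      (Primrec.option_map Primrec.decode ((Primrec.encode.comp hg).comp Primrec.snd).to₂)
      (.const 0)
  obtain ⟨e', he'⟩ := exists_index_push (n := 1) [fun v =>
      ((Encodable.decode (α := α) (v.get 0)).map fun x => Encodable.encode (g x)).getD 0]
    (by
      simp only [List.mem_singleton, forall_eq]
      exact hg'.comp (Primrec.vector_get.comp .id (.const 0))) e
  refine ⟨e', fun i x w => he' Φ _ _ ⟨[Encodable.encode x], rfl⟩ w _ ?_⟩
  have h := he i (g x) (Encodable.encode x :: w)
  simpa [List.Vector.get, List.Vector.toList] using h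

theorem id : KleeneComp Φ E fun _ (n : ℕ) => n :=
  ⟨seqCode [3], fun _ n w => KleeneEval.s3 _ _ n w⟩

theorem of_primrec {g : α → ℕ} (hg : Primrec g) : KleeneComp Φ E fun _ x => g x :=
  id.comp_prim hg

theorem map {ψ : ι → α → ℕ} (hψ : KleeneComp Φ E ψ) {g : ℕ → ℕ} (hg : Primrec g) :
    KleeneComp Φ E fun i x => g (ψ i x) :=
  bind (φ := fun _ p => g p.1) (of_primrec (hg.comp .fst)) hψ

theorem map₂ {φ ψ : ι → α → ℕ} (hφ : KleeneComp Φ E φ) (hψ : KleeneComp Φ E ψ)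
    {g : ℕ → ℕ → ℕ} (hg : Primrec₂ g) : KleeneComp Φ E fun i x => g (φ i x) (ψ i x) := by
  have h1 : KleeneComp Φ E fun i (p : ℕ × α) => g p.1 (ψ i p.2) :=
    bind (φ := fun _ q => g q.2.1 q.1) (ψ := fun i (p : ℕ × α) => ψ i p.2)
      (of_primrec (hg.comp (.comp .fst .snd) .fst)) (hψ.comp_prim .snd)
  exact h1.bind hφ

theorem congr {φ ψ : ι → α → ℕ} (hφ : KleeneComp Φ E φ) (h : ∀ i x, φ i x = ψ i x) :
    KleeneComp Φ E ψ := by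
  rwa [← show φ = ψ from funext fun i => funext (h i)]

/-- Application of a function that the environment supplies first. -/
theorem fun_apply {y : ι → ℕ → ℕ} {r : ι → List (ℕ → ℕ)} (hE : ∀ i, (E i).2 = y i :: r i) :
    KleeneComp Φ E fun i n => y i n := by
  refine ⟨seqCode [7], fun i n w => ?_⟩
  rw [hE i]
  exact KleeneEval.s7 _ _ _ _ _

/-- An index for a function of a pair runs on the two components as separate arguments. -/
theorem exists_index_curry {φ : ι → ℕ × α → ℕ} (hφ : KleeneComp Φ E φ) :
    ∃ e, ∀ (i : ι) (n : ℕ) (x : α) (w : List ℕ),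
      KleeneEval Φ e [suslin, (E i).1] (E i).2 (n :: Encodable.encode x :: w) (φ i (n, x)) := by
  obtain ⟨e, he⟩ := hφ
  obtain ⟨e', he'⟩ := exists_index_push (n := 2) [fun v => Nat.pair (v.get 0) (v.get 1)]
    (by
      simp only [List.mem_singleton, forall_eq]
      exact Primrec₂.natPair.comp (Primrec.vector_get.comp .id (.const 0))
        (Primrec.vector_get.comp .id (.const 1))) e
  exact ⟨e', fun i n x w =>
    he' Φ _ _ ⟨[n, Encodable.encode x], rfl⟩ w _ (he i (n, x) _)⟩

theorem suslin_apply {φ : ι → ℕ × α → ℕ} (hφ : KleeneComp Φ E φ) :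
    KleeneComp Φ E fun i x => suslin fun n => φ i (n, x) := by
  obtain ⟨e, he⟩ := hφ.exists_index_curry
  exact ⟨seqCode [8, 2, e], fun i x w => KleeneEval.s8_two _ fun n => he i n x w⟩

/-- Application of the functional of type 2 supplied by the environment. As scheme S8 applies the
first functional of type 2, S6 exchanges it with the Suslin functional, and exchanges the two
back in the argument. -/
theorem type2_apply {φ : ι → ℕ × α → ℕ} (hφ : KleeneComp Φ E φ) :
    KleeneComp Φ E fun i x => (E i).1 fun n => φ i (n, x) := by
  obtain ⟨e, he⟩ := hφ.exists_index_curry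
  have hswap : ∀ (e c : ℕ) (H K : Type2) (f : List (ℕ → ℕ)) (a : List ℕ),
      KleeneEval Φ e [K, H] f a c →
        KleeneEval Φ (seqCode [6, e, seqCode [1, 0], seqCode [], seqCode []]) [H, K] f a c := by
    intro e c H K f a h
    refine KleeneEval.s6 ⟨by simp, by decide⟩ (isPermOf_nil _) (isPermOf_nil _) ?_
    rw [permute_nil, permute_nil]
    exact h
  exact ⟨_, fun i x w => hswap _ _ _ _ _ _
    (KleeneEval.s8_two _ fun n => hswap _ _ _ _ _ _ (he i n x w))⟩

/-- Application of the first functional of type 3. -/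
theorem type3_apply {M : Type3} {Φ' : List Type3} {G : ι → Type2} {ψ : ι × (ℕ → ℕ) → α → ℕ}
    (h : KleeneComp (M :: Φ') (fun p : ι × (ℕ → ℕ) => (G p.1, [p.2])) ψ) :
    KleeneComp (M :: Φ') (fun i => (G i, [])) fun i x => M fun y => ψ (i, y) x := by
  obtain ⟨e, he⟩ := h
  exact ⟨seqCode [8, 3, 0, e], fun i x w =>
    KleeneEval.s8_three (φ := M) rfl _ fun y => he (i, y) x w⟩

end KleeneComp

open Classical in
/-- A predicate is decided if its characteristic function is computed; the value `0` stands for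
truth, as in the convention for the Suslin functional. -/
def KleeneDec (Φ : List Type3) {ι α : Type*} [Primcodable α] (E : ι → Type2 × List (ℕ → ℕ))
    (P : ι → α → Prop) : Prop :=
  KleeneComp Φ E fun i x => if P i x then 0 else 1

namespace KleeneDec

variable {Φ : List Type3} {ι α β : Type*} [Primcodable α] [Primcodable β]
  {E : ι → Type2 × List (ℕ → ℕ)} {P Q : ι → α → Prop}

theorem of_eq_zero {φ : ι → α → ℕ} (h : KleeneComp Φ E φ) (hP : ∀ i x, P i x ↔ φ i x = 0) :
    KleeneDec Φ E P := by
  refine (h.map (g := fun n => if n = 0 then 0 else 1)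
    (Primrec.ite (Primrec.eq.comp .id (.const 0)) (.const 0) (.const 1))).congr fun i x => ?_
  simp only [hP]

theorem of_primrecPred {p : α → Prop} (h : PrimrecPred p) : KleeneDec Φ E fun _ x => p x := by
  classical
  refine (KleeneComp.of_primrec (g := fun x => if p x then 0 else 1)
    (Primrec.ite h (.const 0) (.const 1))).congr fun i x => ?_
  congr

theorem comp_prim {P : ι → β → Prop} (h : KleeneDec Φ E P) {g : α → β} (hg : Primrec g) :
    KleeneDec Φ E fun i x => P i (g x) :=
  KleeneComp.comp_prim h hg

theorem not (h : KleeneDec Φ E P) : KleeneDec Φ E fun i x => ¬ P i x := by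
  refine (KleeneComp.map h (g := fun n => 1 - n)
    (Primrec.nat_sub.comp (.const 1) .id)).congr fun i x => ?_
  by_cases hP : P i x <;> simp [hP]

theorem or (hP : KleeneDec Φ E P) (hQ : KleeneDec Φ E Q) :
    KleeneDec Φ E fun i x => P i x ∨ Q i x := by
  refine (KleeneComp.map₂ hP hQ (g := fun m n => m * n) Primrec.nat_mul).congr fun i x => ?_
  by_cases hP : P i x <;> by_cases hQ : Q i x <;> simp [hP, hQ]

theorem congr (hP : KleeneDec Φ E P) (h : ∀ i x, P i x ↔ Q i x) : KleeneDec Φ E Q := by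
  rwa [← show P = Q from funext fun i => funext fun x => propext (h i x)]

theorem and (hP : KleeneDec Φ E P) (hQ : KleeneDec Φ E Q) :
    KleeneDec Φ E fun i x => P i x ∧ Q i x :=
  (hP.not.or hQ.not).not.congr fun i x => by tauto

theorem iff (hP : KleeneDec Φ E P) (hQ : KleeneDec Φ E Q) :
    KleeneDec Φ E fun i x => (P i x ↔ Q i x) :=
  ((hP.and hQ).or (hP.not.and hQ.not)).congr fun i x => by tauto

/-- The Suslin functional decides quantification over functions of their initial segments. -/
theorem forall_exists_initSeg {P : ι → List ℕ × α → Prop} (h : KleeneDec Φ E P) :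
    KleeneDec Φ E fun i x => ∀ g : ℕ → ℕ, ∃ n, P i ((List.range n).map g, x) := by
  have hdec : Primrec fun p : ℕ × α => ((Encodable.decode (α := List ℕ) p.1).getD [], p.2) :=
    Primrec.pair (Primrec.option_getD.comp (Primrec.decode.comp .fst) (.const [])) .snd
  refine (KleeneComp.suslin_apply (h.comp_prim hdec)).congr fun i x => ?_
  have hkey : ∀ l : List ℕ, (Encodable.decode (α := List ℕ) (seqCode l)).getD [] = l :=
    fun l => congrArg (fun o => Option.getD o []) (Encodable.encodek l)
  classical
  refine if_congr (forall_congr' fun g => exists_congr fun n => ?_) rfl rfl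
  beta_reduce
  unfold initSegCode
  rw [hkey]
  simp

/-- A numerical quantifier is the special case of a predicate of the length of the initial
segment. -/
theorem exists_nat {P : ι → ℕ × α → Prop} (h : KleeneDec Φ E P) :
    KleeneDec Φ E fun i x => ∃ n, P i (n, x) := by
  have h' : KleeneDec Φ E fun i (p : List ℕ × α) => P i (p.1.length, p.2) :=
    h.comp_prim (Primrec.pair (Primrec.list_length.comp .fst) .snd)
  refine h'.forall_exists_initSeg.congr fun i x => ?_
  simp

theorem forall_nat {P : ι → ℕ × α → Prop} (h : KleeneDec Φ E P) :
    KleeneDec Φ E fun i x => ∀ n, P i (n, x) :=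
  h.not.exists_nat.not.congr fun i x => by simp

/-- Well-foundedness is decided by the Suslin functional. -/
theorem acc {r : ι → ℕ → ℕ → Prop} (h : KleeneDec Φ E fun i (p : ℕ × ℕ) => r i p.1 p.2) :
    KleeneDec Φ E fun i m => Acc (r i) m := by
  -- the initial segment `s` shows that `m`, `s 0`, `s 1`, … is not a descending chain
  have hg : Primrec fun q : ℕ × List ℕ × ℕ =>
      (q.2.1.getD q.1 0, (q.2.2 :: q.2.1).getD q.1 0) :=
    Primrec.pair ((Primrec.list_getD 0).comp (Primrec.fst.comp .snd) .fst)
      ((Primrec.list_getD 0).comp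
        (Primrec.list_cons.comp (Primrec.snd.comp .snd) (Primrec.fst.comp .snd)) .fst)
  have hlt : PrimrecPred fun q : ℕ × List ℕ × ℕ => q.1 < q.2.1.length :=
    Primrec.nat_lt.comp .fst (Primrec.list_length.comp (Primrec.fst.comp .snd))
  refine (((of_primrecPred hlt).and (h.comp_prim hg).not).exists_nat).forall_exists_initSeg.congr
    fun i m => ?_
  rw [acc_iff_isEmpty_descending_chain, isEmpty_subtype]
  constructor
  · rintro H f ⟨h0, hf⟩
    obtain ⟨n, k, hk, hr⟩ := H fun j => f (j + 1)
    simp only [List.length_map, List.length_range] at hk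
    refine hr ?_
    have := hf k
    cases k with
    | zero => simpa [List.getD_eq_getElem?_getD, hk, h0] using this
    | succ k => simpa [List.getD_eq_getElem?_getD, hk, Nat.lt_of_succ_lt hk] using this
  · intro H g
    by_contra! hcon
    refine H (fun | 0 => m | k + 1 => g k) ⟨rfl, fun k => ?_⟩
    have := hcon (k + 1) k (by simp)
    cases k with
    | zero => simpa [List.getD_eq_getElem?_getD] using this
    | succ k => simpa [List.getD_eq_getElem?_getD] using this

end KleeneDec

/-- Definition by cases. -/
theorem KleeneComp.ite {Φ : List Type3} {ι α : Type*} [Primcodable α]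
    {E : ι → Type2 × List (ℕ → ℕ)} {P : ι → α → Prop} [∀ i x, Decidable (P i x)]
    {φ ψ : ι → α → ℕ} (hP : KleeneDec Φ E P) (hφ : KleeneComp Φ E φ) (hψ : KleeneComp Φ E ψ) :
    KleeneComp Φ E fun i x => if P i x then φ i x else ψ i x := by
  refine ((hφ.map₂ (KleeneComp.map hP (g := fun n => 1 - n)
    (Primrec.nat_sub.comp (.const 1) .id)) Primrec.nat_mul).map₂
      (hψ.map₂ hP Primrec.nat_mul) Primrec.nat_add).congr fun i x => ?_
  by_cases h : P i x <;> simp [h]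

/-- Unbounded search. The index `u` on arguments `d, n, x` returns `n` if `P (n, x)` holds, and
otherwise runs `d` on `d, n + 1, x`, by enumeration S9; the search is `u` with `d = u`. -/
theorem KleeneComp.find {Φ : List Type3} {ι α : Type*} [Primcodable α]
    {E : ι → Type2 × List (ℕ → ℕ)} {P : ι → ℕ × α → Prop} (hP : KleeneDec Φ E P)
    (hex : ∀ i x, ∃ n, P i (n, x)) : KleeneComp Φ E fun i x => sInf {n | P i (n, x)} := by
  classical
  obtain ⟨p, hp⟩ := KleeneComp.exists_index_curry hP
  have hget : ∀ {n : ℕ} (j : Fin n), Primrec fun v : List.Vector ℕ n => v.get j :=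
    fun j => Primrec.vector_get.comp .id (.const j)
  -- the test, on arguments `d, n, x`
  obtain ⟨t, ht⟩ := exists_index_push (n := 3) [fun v => v.get 1, fun v => v.get 2]
    (by simp only [List.mem_cons, List.not_mem_nil, or_false, forall_eq_or_imp, forall_eq]
        exact ⟨hget 1, hget 2⟩) p
  -- the branch that stops
  obtain ⟨i₁, h₁⟩ := exists_index_push (n := 3) [fun v => v.get 1]
    (by simp only [List.mem_cons, List.not_mem_nil, or_false, forall_eq]
        exact hget 1) (seqCode [3])
  -- the branch that continues
  obtain ⟨i₂, h₂⟩ := exists_index_push (n := 3)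
    [fun v => v.get 0, fun v => v.get 0, fun v => v.get 1 + 1, fun v => v.get 2]
    (by simp only [List.mem_cons, List.not_mem_nil, or_false, forall_eq_or_imp, forall_eq]
        exact ⟨hget 0, hget 0, Primrec.succ.comp (hget 1), hget 2⟩) (seqCode [9])
  -- the value of the test selects the index of a branch, which S9 runs
  obtain ⟨s, hs⟩ := exists_index_push (n := 1) [fun v => if v.get 0 = 0 then i₁ else i₂]
    (by simp only [List.mem_cons, List.not_mem_nil, or_false, forall_eq]
        exact Primrec.ite (Primrec.eq.comp (hget 0) (.const 0)) (.const i₁) (.const i₂))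
    (seqCode [3])
  set c := seqCode [4, s, t] with hc
  set u := seqCode [4, seqCode [9], c] with hu
  have hsel : ∀ (i : ι) (d n : ℕ) (x : α) (w : List ℕ),
      KleeneEval Φ c [suslin, (E i).1] (E i).2 (d :: n :: Encodable.encode x :: w)
        (if P i (n, x) then i₁ else i₂) := by
    intro i d n x w
    refine KleeneEval.s4
      (ht Φ _ _ ⟨[d, n, Encodable.encode x], rfl⟩ w _ (hp i n x _)) ?_
    refine hs Φ _ _ ⟨[if P i (n, x) then 0 else 1], rfl⟩ _ _ ?_
    by_cases h : P i (n, x) <;>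
      simpa [h, List.Vector.get] using KleeneEval.s3 _ _ _ _
  have hrun : ∀ (i : ι) (x : α) (k n : ℕ) (w : List ℕ), n + k = Nat.find (hex i x) →
      KleeneEval Φ u [suslin, (E i).1] (E i).2 (u :: n :: Encodable.encode x :: w)
        (Nat.find (hex i x)) := by
    intro i x k
    induction k with
    | zero =>
      intro n w hn
      have hPn : P i (n, x) := by
        have := Nat.find_spec (hex i x)
        rwa [← hn] at this
      have hsel' := hsel i u n x w
      rw [if_pos hPn] at hsel'
      refine KleeneEval.s4 hsel' (KleeneEval.s9 ?_)
      refine h₁ Φ _ _ ⟨[u, n, Encodable.encode x], rfl⟩ w _ ?_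
      rw [← hn]
      exact KleeneEval.s3 _ _ _ _
    | succ k ih =>
      intro n w hn
      have hPn : ¬ P i (n, x) := Nat.find_min (hex i x) (by omega)
      have hsel' := hsel i u n x w
      rw [if_neg hPn] at hsel'
      refine KleeneEval.s4 hsel' (KleeneEval.s9 ?_)
      refine h₂ Φ _ _ ⟨[u, n, Encodable.encode x], rfl⟩ w _ ?_
      exact KleeneEval.s9 (ih (n + 1) _ (by omega))
  refine ⟨seqCode [4, seqCode [4, u, seqCode [2, u]], seqCode [2, 0]], fun i x w => ?_⟩
  have hfind : sInf {n | P i (n, x)} = Nat.find (hex i x) :=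
    Nat.sInf_def (s := {n | P i (n, x)}) (hex i x)
  beta_reduce
  rw [hfind]
  exact KleeneEval.s4 (KleeneEval.s2 0 _ _ _)
    (KleeneEval.s4 (KleeneEval.s2 u _ _ _) (hrun i x _ 0 w (Nat.zero_add _)))

/-! ### Deciding the correctness of an alleged history -/

/-- The relation on numbers that a function codes. -/
def relOfFun (y : ℕ → ℕ) (n m : ℕ) : Prop := y (Nat.pair n m) ≠ 0

/-- The environments that consist of one functional of type 2 and one function. -/
def funEnv (p : Type2 × (ℕ → ℕ)) : Type2 × List (ℕ → ℕ) := (p.1, [p.2])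

/-- A family of sets of numbers, depending on an element of `α`, is decided. -/
def KleeneDecSet (Φ : List Type3) {α : Type*} [Primcodable α]
    (C : Type2 × (ℕ → ℕ) → α → Set ℕ) : Prop :=
  KleeneDec Φ funEnv fun p (q : ℕ × α) => q.1 ∈ C p q.2

section

variable {Φ : List Type3} {α : Type*} [Primcodable α] {C D : Type2 × (ℕ → ℕ) → α → Set ℕ}

theorem kleeneDec_relOfFun :
    KleeneDec Φ funEnv fun p (q : ℕ × ℕ) => relOfFun p.2 q.1 q.2 := by
  have h : KleeneComp Φ funEnv fun p n => p.2 n :=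
    KleeneComp.fun_apply (r := fun _ => []) fun _ => rfl
  exact (KleeneDec.of_eq_zero (h.comp_prim Primrec₂.natPair) fun _ _ => Iff.rfl).not

theorem mem_setOp_mapOfCode {G : Type2} {s : Set ℕ} {n : ℕ} :
    n ∈ setOp (mapOfCode G) s ↔ G (consFun n (charCantor s).toBaire) ≠ 0 := by
  change mapOfCode G (charCantor s) n = 1 ↔ _
  rw [Fin.ext_iff]
  change min (G (consFun n (charCantor s).toBaire)) 1 = 1 ↔ _
  omega

open Classical in
theorem KleeneDecSet.setOp (h : KleeneDecSet Φ C) :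
    KleeneDecSet Φ fun p x => setOp (mapOfCode p.1) (C p x) := by
  have h1 : KleeneDec Φ funEnv fun p (q : ℕ × ℕ × α) => q.1 - 1 ∈ C p q.2.2 :=
    h.comp_prim (.pair (Primrec.pred.comp .fst) (.comp .snd .snd))
  have h0 : KleeneDec Φ funEnv fun _ (q : ℕ × ℕ × α) => q.1 = 0 :=
    .of_primrecPred (Primrec.eq.comp .fst (.const 0))
  have h2 : KleeneComp Φ funEnv fun p (q : ℕ × ℕ × α) =>
      if q.1 = 0 then q.2.1 else if q.1 - 1 ∈ C p q.2.2 then 1 else 0 :=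
    .ite h0 (.of_primrec (.comp .fst .snd))
      (.ite h1 (.of_primrec (.const 1)) (.of_primrec (.const 0)))
  refine (KleeneDec.of_eq_zero h2.type2_apply fun _ _ => Iff.rfl).not.congr fun p q => ?_
  rw [mem_setOp_mapOfCode]
  have hfun : (fun n => if n = 0 then q.1 else if n - 1 ∈ C p q.2 then 1 else 0) =
      consFun q.1 (charCantor (C p q.2)).toBaire := by
    funext n
    cases n with
    | zero => rfl
    | succ n =>
      by_cases hn : n ∈ C p q.2 <;> simp [consFun, Cantor.toBaire, charCantor, hn]
  exact not_congr (by rw [← hfun]; rfl)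

theorem kleeneDecSet_row : KleeneDecSet Φ fun p m => row (relOfFun p.2) m :=
  kleeneDec_relOfFun

theorem KleeneDecSet.subset (hC : KleeneDecSet Φ C) (hD : KleeneDecSet Φ D) :
    KleeneDec Φ funEnv fun p x => C p x ⊆ D p x :=
  (KleeneDec.or (KleeneDec.not hC) hD).forall_nat.congr fun p x =>
    forall_congr' fun n => (imp_iff_not_or (a := n ∈ C p x)).symm

theorem KleeneDecSet.unionNext (hC : KleeneDecSet Φ C) :
    KleeneDecSet Φ fun p x => unionNext (mapOfCode p.1) (relOfFun p.2) (C p x) := by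
  have hm : KleeneDec Φ funEnv fun p (q : ℕ × ℕ × α) => q.1 ∈ C p q.2.2 :=
    hC.comp_prim (.pair .fst (.comp .snd .snd))
  have hsw : Primrec fun q : ℕ × ℕ × α => (q.2.1, q.1) := .pair (.comp .fst .snd) .fst
  exact (hm.and ((KleeneDec.comp_prim kleeneDecSet_row hsw).or
    (KleeneDec.comp_prim kleeneDecSet_row.setOp hsw))).exists_nat

theorem KleeneDecSet.isNext (hC : KleeneDecSet Φ C) :
    KleeneDecSet Φ fun p x => {n | IsNext (mapOfCode p.1) (C p x) n} :=
  (KleeneDec.not hC).and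
    (KleeneDec.or hC.setOp (KleeneDec.comp_prim (hC.setOp.subset hC) .snd))

theorem kleeneDec_locallyCorrect :
    KleeneDec Φ funEnv fun p m => LocallyCorrect (mapOfCode p.1) (relOfFun p.2) m := by
  have hrow := kleeneDecSet_row (Φ := Φ)
  have hU := hrow.unionNext
  have hself : KleeneDec Φ funEnv fun p m =>
      m ∈ _root_.setOp (mapOfCode p.1) (row (relOfFun p.2) m) :=
    KleeneDec.comp_prim hrow.setOp (g := fun m : ℕ => (m, m)) (.pair .id .id)
  exact (((hrow.subset hU).and (hU.subset hrow)).and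
    (hself.or (hrow.setOp.subset hrow))).congr fun p m =>
      and_congr Set.Subset.antisymm_iff.symm Iff.rfl

theorem kleeneDec_verified :
    KleeneDec Φ funEnv fun p m => Verified (mapOfCode p.1) (relOfFun p.2) m :=
  KleeneDec.acc (r := fun (p : Type2 × (ℕ → ℕ)) => errorRel (mapOfCode p.1) (relOfFun p.2))
    (kleeneDec_relOfFun.or ((kleeneDec_locallyCorrect.not.comp_prim .snd).and
      (.of_primrecPred (Primrec.eq.comp .fst .snd))))

theorem kleeneDec_errorAt : KleeneDec Φ funEnv fun p (q : ℕ × ℕ) =>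
    ErrorAt (mapOfCode p.1) (relOfFun p.2) q.1 q.2 := by
  have hB : KleeneDecSet Φ fun p (_ : ℕ) => _root_.unionNext (mapOfCode p.1) (relOfFun p.2)
      {m | Verified (mapOfCode p.1) (relOfFun p.2) m} :=
    KleeneDecSet.unionNext (KleeneDec.comp_prim kleeneDec_verified .fst)
  have h1 : KleeneDec Φ funEnv fun p (q : ℕ × ℕ × ℕ) =>
      Verified (mapOfCode p.1) (relOfFun p.2) q.1 :=
    kleeneDec_verified.comp_prim .fst
  have h2 := KleeneDec.comp_prim (kleeneDecSet_row (Φ := Φ)).isNext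
    (g := fun q : ℕ × ℕ × ℕ => (q.2.2, q.1)) (.pair (.comp .snd .snd) .fst)
  have h3 : KleeneDec Φ funEnv fun p (q : ℕ × ℕ × ℕ) => relOfFun p.2 q.2.1 q.2.2 :=
    kleeneDec_relOfFun.comp_prim .snd
  have h4 := KleeneDec.comp_prim (kleeneDecSet_row (Φ := Φ))
    (g := fun q : ℕ × ℕ × ℕ => (q.2.1, q.1)) (.pair (.comp .fst .snd) .fst)
  have h5 := KleeneDec.comp_prim hB.isNext (g := fun q : ℕ × ℕ => (q.2, 0))
    (.pair .snd (.const 0))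
  have h6 := KleeneDec.comp_prim hB (g := fun q : ℕ × ℕ => (q.1, 0)) (.pair .fst (.const 0))
  exact ((h1.and (h2.and (h3.iff h4).not)).exists_nat).or
    (h5.and (kleeneDec_relOfFun.iff h6).not)

end

/-! ### The probe and the realiser -/

open Classical in
/-- At the true history the probe is `k` or `0`, according to whether `b` enters. At any other
relation it is a length of initial segments that suffices to tell this relation from the true
history. -/
noncomputable def probe (F : Cantor → Cantor) (b k : ℕ) (R : ℕ → ℕ → Prop) : ℕ :=
  if ∀ m, Verified F R m then
    if b ∈ setOp F (row R b) then k else 0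
  else sInf {q | ErrorAt F R q.unpair.1 q.unpair.2} + 1

theorem kleeneComp_probe (Φ : List Type3) : KleeneComp Φ funEnv fun p (q : ℕ × ℕ) =>
    probe (mapOfCode p.1) q.1 q.2 (relOfFun p.2) := by
  classical
  have hall : ∀ {α : Type} [Primcodable α], KleeneDec Φ funEnv fun p (_ : α) =>
      ∀ m, Verified (mapOfCode p.1) (relOfFun p.2) m := fun {α} _ =>
    KleeneDec.forall_nat (P := fun (p : Type2 × (ℕ → ℕ)) (q : ℕ × α) =>
      Verified (mapOfCode p.1) (relOfFun p.2) q.1) (kleeneDec_verified.comp_prim .fst)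
  have herr : KleeneDec Φ funEnv fun p (q : ℕ × ℕ × ℕ) =>
      ErrorAt (mapOfCode p.1) (relOfFun p.2) q.1.unpair.1 q.1.unpair.2 :=
    kleeneDec_errorAt.comp_prim (Primrec.unpair.comp .fst)
  -- the second alternative makes the search total
  have hfind := KleeneComp.find (herr.or hall) (by
    intro p q
    by_cases h : ∀ m, Verified (mapOfCode p.1) (relOfFun p.2) m
    · exact ⟨0, Or.inr h⟩
    · obtain ⟨j, n, hjn⟩ := exists_errorAt h
      exact ⟨Nat.pair j n, Or.inl (by simpa using hjn)⟩)
  have hmem := KleeneDec.comp_prim (kleeneDecSet_row (Φ := Φ)).setOp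
    (g := fun q : ℕ × ℕ => (q.1, q.1)) (.pair .fst .fst)
  refine (KleeneComp.ite hall (KleeneComp.ite hmem (.of_primrec .snd) (.of_primrec (.const 0)))
    (hfind.map Primrec.succ)).congr fun p q => ?_
  unfold probe
  by_cases h : ∀ m, Verified (mapOfCode p.1) (relOfFun p.2) m
  · rw [if_pos h, if_pos h]
  · rw [if_neg h, if_neg h]
    simp only [h, or_false, Nat.succ_eq_add_one]

variable {F : Cantor → Cantor}

theorem mem_setOp_row_of_verified {R : ℕ → ℕ → Prop} (h : ∀ m, Verified F R m) (b : ℕ) :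
    b ∈ setOp F (row R b) ↔ b ∈ finalSet F := by
  rw [(h b).row_eq, mem_finalSet_iff]

theorem probe_of_notMem {b : ℕ} (hb : b ∉ finalSet F) (k k' : ℕ) : probe F b k = probe F b k' := by
  funext R
  unfold probe
  split_ifs with h h'
  · exact absurd ((mem_setOp_row_of_verified h b).1 h') hb
  · rfl
  · rfl

theorem probe_history {b : ℕ} (hb : b ∈ finalSet F) (k : ℕ) : probe F b k (history F) = k := by
  unfold probe
  rw [if_pos (verified_history F), if_pos ((mem_setOp_row_of_verified (verified_history F) b).2 hb)]

/-- The history, coded as an element of Cantor space. -/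
noncomputable def historyCantor (F : Cantor → Cantor) : Cantor :=
  charCantor {q | history F q.unpair.1 q.unpair.2}

theorem relOfFun_historyCantor : relOfFun (historyCantor F).toBaire = history F := by
  funext n m
  by_cases h : history F n m <;> simp [relOfFun, Cantor.toBaire, historyCantor, charCantor, h]

/-- Only the neighbourhood that the probe assigns to the history itself contains the history. -/
theorem eq_historyCantor_of_agree {b k : ℕ} {f : Cantor}
    (h : ∀ i < probe F b k (relOfFun f.toBaire), historyCantor F i = f i) :
    f = historyCantor F := by
  by_cases hv : ∀ m, Verified F (relOfFun f.toBaire) m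
  · funext q
    have hrow := Set.ext_iff.1 (hv q.unpair.2).row_eq q.unpair.1
    rw [← relOfFun_historyCantor] at hrow
    have hq : (f q : ℕ) ≠ 0 ↔ (historyCantor F q : ℕ) ≠ 0 := by
      simpa [row, relOfFun, Cantor.toBaire, Nat.pair_unpair] using hrow
    omega
  · exfalso
    obtain ⟨j, n, hjn⟩ := exists_errorAt hv
    set q := sInf {q : ℕ | ErrorAt F (relOfFun f.toBaire) q.unpair.1 q.unpair.2} with hq
    have hmem : ErrorAt F (relOfFun f.toBaire) q.unpair.1 q.unpair.2 :=
      Nat.sInf_mem (s := {q : ℕ | ErrorAt F (relOfFun f.toBaire) q.unpair.1 q.unpair.2})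
        ⟨Nat.pair j n, by simpa using hjn⟩
    have hlt : q < probe F b k (relOfFun f.toBaire) := by
      unfold probe
      rw [if_neg hv]
      exact Nat.lt_succ_self _
    refine hmem.not_iff ?_
    rw [← relOfFun_historyCantor]
    simp [relOfFun, Cantor.toBaire, Nat.pair_unpair, h q hlt]

theorem le_realiser_probe {M : (Cantor → ℕ) → ℕ} (hM : IsPincherleRealiser M) {b : ℕ}
    (hb : b ∈ finalSet F) (k : ℕ) : k ≤ M fun f => probe F b k (relOfFun f.toBaire) := by
  classical
  have h := hM (fun f => probe F b k (relOfFun f.toBaire))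
    (fun g => if g = historyCantor F then k else 0) (by
      intro f g hfg
      by_cases hg : g = historyCantor F
      · subst hg
        have hf := eq_historyCantor_of_agree hfg
        subst hf
        simp [relOfFun_historyCantor, probe_history hb]
      · simp [hg]) (historyCantor F)
  simpa using h

/-- The realiser decides whether `b` enters: if it does, the values of the realiser at the probes
are unbounded in `k`, and otherwise the probes do not depend on `k`. -/
theorem mem_finalSet_iff_realiser_ne {M : (Cantor → ℕ) → ℕ} (hM : IsPincherleRealiser M) (b : ℕ) :
    b ∈ finalSet F ↔
      (M fun f => probe F b ((M fun f => probe F b 0 (relOfFun f.toBaire)) + 1)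
        (relOfFun f.toBaire)) ≠ M fun f => probe F b 0 (relOfFun f.toBaire) := by
  constructor
  · intro hb
    have := le_realiser_probe hM hb ((M fun f => probe F b 0 (relOfFun f.toBaire)) + 1)
    omega
  · intro h
    by_contra hb
    exact h (by rw [probe_of_notMem hb _ 0])

theorem mainTheorem8 (M : (Cantor → ℕ) → ℕ) (hM : IsPincherleRealiser M) :
    KleeneComputableIn [pureOfCantor M] [suslin]
      (fun G b => (nonMonotoneInd (mapOfCode G) b : ℕ)) := by
  classical
  set Φ : List Type3 := [pureOfCantor M] with hΦ
  have hval : KleeneComp Φ (fun G : Type2 => (G, [])) fun G (q : ℕ × ℕ) =>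
      M fun f => probe (mapOfCode G) q.1 q.2 (relOfFun f.toBaire) :=
    KleeneComp.type3_apply (G := fun G => G) (kleeneComp_probe Φ)
  have hval₀ := hval.comp_prim (g := fun b : ℕ => (b, 0)) (.pair .id (.const 0))
  have hval₁ := (hval.comp_prim (g := fun q : ℕ × ℕ => (q.2, q.1 + 1))
    (.pair .snd (Primrec.succ.comp .fst))).bind hval₀
  obtain ⟨e, he⟩ := hval₁.map₂ hval₀ (g := fun m n => if m = n then 0 else 1)
    (Primrec.ite (Primrec.eq.comp .fst .snd) (.const 0) (.const 1))
  refine ⟨e, fun G b => ?_⟩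
  have hb := mem_finalSet_iff_realiser_ne (F := mapOfCode G) hM b
  have h01 : (nonMonotoneInd (mapOfCode G) b : ℕ) =
      if b ∈ finalSet (mapOfCode G) then 1 else 0 := by
    unfold finalSet
    simp only [Set.mem_ofPred_eq]
    split_ifs <;> omega
  simp only [h01, hb, ne_eq, ite_not]
  exact he G b []
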